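/- **Definitions.** A *model of guarded recursive terms* is a category $\mathcal E$ with finite products, with an endofunctor $\blacktriangleright$ preserving finite limits and a natural transformation $\mathrm{next}\colon \mathrm{id}\to\blacktriangleright$, such that for every $f\colon\blacktriangleright X\to X$ there is a unique $h\colon 1\to X$ with $f\circ\mathrm{next}\circ h=h$. If $\mathcal E$ is moreover cartesian closed, a functor $F\colon\mathcal E\to\mathcal E$ is *locally contractive* if there are morphisms $G_{X,Y}\colon\blacktriangleright(Y^X)\to FY^{FX}$ such that $G_{X,Y}\circ\mathrm{next}\colon Y^X\to FY^{FX}$ takes the name $1\to Y^X$ of each $f\colon X\to Y$ to the name of $Ff$, and such that $G$ respects identities and composition: $G_{X,X}\circ\mathrm{next}\circ\ulcorner\mathrm{id}_X\urcorner=\ulcorner\mathrm{id}_{FX}\urcorner$, and $\mathrm{comp}\circ(G_{X,Y}\times G_{Y,Z})$ equals the composite $\blacktriangleright(Y^X)\times\blacktriangleright(Z^Y)\cong\blacktriangleright(Y^X\times Z^Y)\xrightarrow{\blacktriangleright\mathrm{comp}}\blacktriangleright(Z^X)\xrightarrow{G_{X,Z}}FZ^{FX}$. A *model of guarded recursive types*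 is a cartesian closed model of guarded recursive terms in which every locally contractive $F\colon\mathcal E\to\mathcal E$ has an object $X$ with $FX\cong X$. If $\mathcal E$ has finite limits, each slice $\mathcal E/I$ carries the functor $\blacktriangleright_I$ sending $Y\to I$ to the pullback of $\blacktriangleright Y\to\blacktriangleright I$ along $\mathrm{next}\colon I\to\blacktriangleright I$, and the transformation $\mathrm{next}_I\colon Y\to\blacktriangleright_I Y$ induced by $\mathrm{next}\colon Y\to\blacktriangleright Y$ and $Y\to I$. A *model of guarded recursive dependent types* is a locally cartesian closed model of guarded recursive terms such that every slice $(\mathcal E/I,\blacktriangleright_I,\mathrm{next}_I)$ is a model of guarded recursive types. **Theorem.** 1. Let $A$ be a complete Heyting algebra and $K\subseteq A$ a well-founded basis: every $a\in A$ is the join of $\{k\in K\mid k\le a\}$, and $K$ has no infinite strictly descending sequence. Let $\mathrm{Sh}(A)$ be the category of sheaves for the topology in which a sieve on $a$ covers iff its join is $a$. Put $p(a)=\bigvee\{k\in K\mid k<a\}$ and $\blacktriangleright X=\mathbf a(X\circ p)$, with $\mathbf a$ the associated sheaf functor, and let $\mathrm{next}\colon X\to\blacktriangleright X$ be the restriction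 map $X(a)\to X(p(a))$ followed by the unit $X\circ p\to\mathbf a(X\circ p)$. Then $(\mathrm{Sh}(A),\blacktriangleright,\mathrm{next})$ is a model of guarded recursive dependent types. In particular every slice is a cartesian closed model of guarded recursive terms, in which every locally contractive endofunctor has a fixed point up to isomorphism. 2. In particular, let $P$ be a well-founded partial order. Then the category of presheaves on $P$ is a model of guarded recursive dependent types, with $(\blacktriangleright X)(a)=\lim_{b<a}X(b)$ and $\mathrm{next}(x)=(x|_b)_{b<a}$. (This is the structure obtained from 1 for the complete Heyting algebra of down-closed subsets of $P$, with the principal down-sets as basis.) 3. In particular, the topos of trees $\mathcal S$ of presheaves on $\{1<2<3<\cdots\}$ is a model of guarded recursive dependent types, with $(\blacktriangleright X)(1)=\{\star\}$, $(\blacktriangleright X)(n+1)=X(n)$, and $\mathrm{next}$ given by the map to $\{\star\}$ at stage $1$ and by the restriction map $X(n+1)\to X(n)$ at stage $n+1$. -/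

import Mathlib

open CategoryTheory

universe v u

namespace GuardedRec

section Models

open Limits MonoidalCategory CartesianMonoidalCategory

variable {E : Type u} [Category.{v} E]

/-- `(E, L, next)` is a *model of guarded recursive terms*: `E` has finite products, `L`
(written `▸`) preserves finite limits, and for every `f : ▸X ⟶ X` there is a unique global
element `h : 1 ⟶ X` with `f ∘ next ∘ h = h` (for any choice of the terminal object `1`). -/
structure ModelsGuardedTerms (L : E ⥤ E) (next : 𝟭 E ⟶ L) : Prop where
  hasFiniteProducts : HasFiniteProducts E
  existsUnique_fix : ∀ (T : E) (_ : IsTerminal T) (X : E) (f : L.obj X ⟶ X),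
    ∃! h : T ⟶ X, h ≫ next.app X ≫ f = h
  preservesFiniteLimits : PreservesFiniteLimits L

/-- Let `E` be cartesian closed. A functor `F : E ⥤ E` is *locally contractive* if there are
morphisms `G X Y : ▸(Y ^ X) ⟶ (F Y) ^ (F X)` that respect identities and composition, such that
`G X Y ∘ next` is a strength for `F`, i.e. it takes the name `1 ⟶ Y ^ X` of `f : X ⟶ Y` to the
name of `F f`. Here `(ihom X).obj Y` is the exponential `Y ^ X`, `MonoidalClosed.curry' f` is the
name of `f`, and `MonoidalClosed.id`, `MonoidalClosed.comp` are the internal identities and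
composition. Composition in `▸E` is the composite
`▸(Y ^ X) × ▸(Z ^ Y) ≅ ▸(Y ^ X × Z ^ Y) ⟶ ▸(Z ^ X)`, the first map being the inverse of
`prodComparison`. -/
def LocallyContractive [CartesianMonoidalCategory E] [MonoidalClosed E]
    (L : E ⥤ E) (next : 𝟭 E ⟶ L) (F : E ⥤ E) : Prop :=
  ∃ G : ∀ X Y : E, L.obj ((ihom X).obj Y) ⟶ (ihom (F.obj X)).obj (F.obj Y),
    (∀ (X Y : E) (f : X ⟶ Y),
      MonoidalClosed.curry' f ≫ next.app ((ihom X).obj Y) ≫ G X Y =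
        MonoidalClosed.curry' (F.map f)) ∧
    (∀ X : E,
      MonoidalClosed.id X ≫ next.app ((ihom X).obj X) ≫ G X X = MonoidalClosed.id (F.obj X)) ∧
    (∀ X Y Z : E,
      L.map (MonoidalClosed.comp X Y Z) ≫ G X Z =
        CartesianMonoidalCategory.prodComparison L ((ihom X).obj Y) ((ihom Y).obj Z) ≫ (G X Y ⊗ₘ G Y Z) ≫
          MonoidalClosed.comp (F.obj X) (F.obj Y) (F.obj Z))

/-- `(E, L, next)` is a *model of guarded recursive types*: a cartesian closed model of guarded
recursive terms such that every locally contractive endofunctor has a fixed point up to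
isomorphism. The last condition is stated for every choice of products and exponentials. -/
structure ModelsGuardedTypes (L : E ⥤ E) (next : 𝟭 E ⟶ L) : Prop
    extends ModelsGuardedTerms L next where
  cartesianClosed : ∃ _ : CartesianMonoidalCategory E, Nonempty (MonoidalClosed E)
  exists_fixedPoint : ∀ [CartesianMonoidalCategory E] [MonoidalClosed E] (F : E ⥤ E),
    LocallyContractive L next F → ∃ X : E, Nonempty (F.obj X ≅ X)

/-- The functor `▸_I` on the slice over `I`: apply `▸` and pull back along `next_I : I ⟶ ▸I`. -/
noncomputable def laterOver [HasPullbacks E] (L : E ⥤ E) (next : 𝟭 E ⟶ L) (I : E) :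
    Over I ⥤ Over I :=
  Over.post L ⋙ Over.pullback (next.app I)

/-- The natural transformation `next` of the slice over `I`: its component at `Y ⟶ I` is the map
into the pullback `▸_I Y = ▸Y ×_{▸I} I` given by `next_Y` and `Y ⟶ I`. -/
noncomputable def nextOver [HasPullbacks E] (L : E ⥤ E) (next : 𝟭 E ⟶ L) (I : E) :
    𝟭 (Over I) ⟶ laterOver L next I where
  app Y := Over.homMk (U := Y) (V := (laterOver L next I).obj Y)
    (pullback.lift (f := L.map Y.hom) (g := next.app I) (next.app Y.left) Y.hom
      (next.naturality Y.hom).symm)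
    (pullback.lift_snd (f := L.map Y.hom) (g := next.app I) _ _ _)
  naturality Y Z f := by
    have h : f.left ≫ next.app Z.left = next.app Y.left ≫ L.map f.left := next.naturality f.left
    have hf : L.map f.left ≫ L.map Z.hom = L.map Y.hom := by rw [← L.map_comp, Over.w]
    have key : f.left ≫ pullback.lift (f := L.map Z.hom) (g := next.app I) (next.app Z.left) Z.hom
          (next.naturality Z.hom).symm =
        pullback.lift (f := L.map Y.hom) (g := next.app I) (next.app Y.left) Y.hom
          (next.naturality Y.hom).symm ≫
        pullback.lift (f := L.map Z.hom) (g := next.app I)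
          (pullback.fst (L.map Y.hom) (next.app I) ≫ L.map f.left)
          (pullback.snd (L.map Y.hom) (next.app I))
          (by rw [Category.assoc, hf]; exact pullback.condition) := by
      apply pullback.hom_ext
      · simp only [Category.assoc, pullback.lift_fst, pullback.lift_fst_assoc, h]
      · simp only [Category.assoc, pullback.lift_snd, Over.w]
    exact Over.OverMorphism.ext key

/-- `(E, L, next)` is a *model of guarded recursive dependent types*: a locally cartesian closed
model of guarded recursive terms all of whose slices, with the induced `▸_I` and `next`, are
models of guarded recursive types. (Local cartesian closure is the existence of finite limits
together with the cartesian closure of each slice, which is part of `slice`.) -/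
structure ModelsGuardedDependentTypes [HasFiniteLimits E] (L : E ⥤ E) (next : 𝟭 E ⟶ L) : Prop where
  terms : ModelsGuardedTerms L next
  slice : ∀ I : E, ModelsGuardedTypes (laterOver L next I) (nextOver L next I)

end Models

section Sheaves

variable (A : Type u) [Order.Frame A]

/-- The Grothendieck topology of a complete Heyting algebra: a sieve `S` on `a` is covering
iff the join of its elements is `a`. -/
def frameTopology : GrothendieckTopology A where
  sieves a := {S | sSup {b | ∃ f : b ⟶ a, S f} = a}
  top_mem' a := le_antisymm (sSup_le fun _ ⟨f, _⟩ => leOfHom f) (le_sSup ⟨𝟙 a, trivial⟩)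
  pullback_stable' a b S f hS := by
    refine le_antisymm (sSup_le fun _ ⟨g, _⟩ => leOfHom g) ?_
    calc b = b ⊓ sSup {c | ∃ g : c ⟶ a, S g} := by
          rw [show sSup {c | ∃ g : c ⟶ a, S g} = a from hS, inf_eq_left.2 (leOfHom f)]
      _ ≤ _ := by
          rw [inf_sSup_eq]
          refine iSup₂_le fun c ⟨g, hg⟩ => le_sSup ⟨homOfLE inf_le_left, ?_⟩
          exact S.downward_closed hg (homOfLE inf_le_right)
  transitive' a S hS R hR := by
    refine le_antisymm (sSup_le fun _ ⟨g, _⟩ => leOfHom g) ?_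
    calc a = sSup {b | ∃ f : b ⟶ a, S f} := hS.symm
      _ ≤ _ := by
          refine sSup_le fun b ⟨f, hf⟩ => ?_
          calc b = sSup {c | ∃ g : c ⟶ b, R.pullback f g} := (hR hf).symm
            _ ≤ _ := by
                refine sSup_le_sSup ?_
                rintro c ⟨g, hg⟩
                exact ⟨g ≫ f, hg⟩

variable {A}

/-- `K` is a basis of `A`: every element is the join of the elements of `K` below it. -/
def IsBasis (K : Set A) : Prop :=
  ∀ a : A, IsLUB {k | k ∈ K ∧ k ≤ a} a

/-- The predecessor map `p a = ⋁ {k ∈ K | k < a}`, as a functor `A ⥤ A`. -/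
def pred (K : Set A) : A ⥤ A :=
  Monotone.functor (f := fun a => sSup {k | k ∈ K ∧ k < a})
    fun _ _ hab => sSup_le_sSup fun _ hk => ⟨hk.1, hk.2.trans_le hab⟩

theorem pred_le (K : Set A) (a : A) : (pred K).obj a ≤ a :=
  sSup_le fun _ hk => hk.2.le

/-- The presheaf map `nextᵖʳᵉ : X ⟶ p^* X = X ∘ p`, restricting `x ∈ X(a)` to `X(p a)`. -/
def nextPre (K : Set A) (X : Aᵒᵖ ⥤ Type u) : X ⟶ (pred K).op ⋙ X where
  app a := X.map (homOfLE (pred_le K a.unop)).op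
  naturality _ _ _ := by
    dsimp
    rw [← X.map_comp, ← X.map_comp]
    rfl

/-- `▸ X = 𝐚 (p^* X)` on sheaves, with `𝐚` the associated sheaf functor. -/
noncomputable def laterSheaf (K : Set A) :
    Sheaf (frameTopology A) (Type u) ⥤ Sheaf (frameTopology A) (Type u) :=
  sheafToPresheaf _ _ ⋙ (Functor.whiskeringLeft _ _ _).obj (pred K).op ⋙ presheafToSheaf _ _

/-- `next = η ∘ nextᵖʳᵉ`, with `η : p^* X ⟶ 𝐚 (p^* X)` the unit of sheafification. -/
noncomputable def nextSheaf (K : Set A) :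
    𝟭 (Sheaf (frameTopology A) (Type u)) ⟶ laterSheaf K where
  app X := ⟨nextPre K X.obj ≫ toSheafify (frameTopology A) ((pred K).op ⋙ X.obj)⟩
  naturality X Y f := by
    apply Sheaf.hom_ext
    change f.hom ≫ nextPre K Y.obj ≫ toSheafify _ _ = (nextPre K X.obj ≫ toSheafify _ _) ≫
      sheafifyMap _ (Functor.whiskerLeft (pred K).op f.hom)
    rw [Category.assoc, ← toSheafify_naturality, ← Category.assoc, ← Category.assoc]
    congr 1
    ext a : 2
    exact (f.hom.naturality _).symm

end Sheaves

section Presheaves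

open Opposite

variable (K : Type u) [PartialOrder K]

variable {K} in
/-- The set `lim_{b < a} X(b)` of families `(x_b)_{b < a}` compatible with restriction. -/
def Families (X : Kᵒᵖ ⥤ Type u) (a : K) : Type u :=
  {x : ∀ b : Set.Iio a, X.obj (op b.1) //
    ∀ (b c : Set.Iio a) (h : c.1 ≤ b.1), X.map (homOfLE h).op (x b) = x c}

/-- `▸` on presheaves over a partial order: `(▸X)(a) = lim_{b < a} X(b)`, the set of families
`(x_b)_{b < a}` that are compatible with restriction. This corresponds to `a (p^* X)` under the
equivalence between presheaves on `K` and sheaves on the complete Heyting algebra of down-closed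
subsets of `K`, with the basis of principal down-sets. -/
def laterPresheaf : (Kᵒᵖ ⥤ Type u) ⥤ (Kᵒᵖ ⥤ Type u) where
  obj X :=
    { obj a := Families X a.unop
      map {a a'} f := TypeCat.ofHom fun x =>
        ⟨fun b => x.1 ⟨b.1, lt_of_lt_of_le b.2 (leOfHom f.unop)⟩,
          fun b c h => x.2 ⟨b.1, lt_of_lt_of_le b.2 (leOfHom f.unop)⟩
            ⟨c.1, lt_of_lt_of_le c.2 (leOfHom f.unop)⟩ h⟩ }
  map φ :=
    { app a := TypeCat.ofHom fun x =>
        ⟨fun b => φ.app _ (x.1 b), fun b c h => by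
          rw [← NatTrans.naturality_apply, x.2 b c h]⟩ }

/-- `next` on presheaves over a partial order: `x ∈ X(a)` goes to its restrictions
`(x|_b)_{b < a}`. -/
def nextPresheaf : 𝟭 (Kᵒᵖ ⥤ Type u) ⟶ laterPresheaf K where
  app X :=
    { app a := TypeCat.ofHom fun x => show Families X a.unop from
        ⟨fun b => X.map (homOfLE (le_of_lt b.2)).op x, fun b c h => by
          rw [← Functor.map_comp_apply]; rfl⟩
      naturality a a' f := by
        ext x
        apply Subtype.ext
        funext b
        exact (Functor.map_comp_apply X _ _ x).symm }
  naturality X Y φ := by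
    ext a x
    apply Subtype.ext
    funext b
    exact (NatTrans.naturality_apply φ _ x).symm

end Presheaves

section Trees

open Opposite

/-- The topos of trees: presheaves on `ω = {1 < 2 < 3 < ⋯}`. Index `n : ℕ` stands for the
stage `n + 1`. -/
abbrev Trees : Type (u + 1) := ℕᵒᵖ ⥤ Type u

/-- The sets `▸X(1) = {⋆}`, `▸X(n + 1) = X(n)`. -/
def laterTreesObj (X : Trees.{u}) : ℕ → Type u
  | 0 => PUnit
  | n + 1 => X.obj (op n)

/-- The restriction maps `▸X(n + 1) → ▸X(n)`. -/
def laterTreesRes (X : Trees.{u}) : ∀ n, laterTreesObj X (n + 1) ⟶ laterTreesObj X n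
  | 0 => TypeCat.ofHom fun _ => PUnit.unit
  | n + 1 => X.map (homOfLE (Nat.le_succ n)).op

/-- The action of `▸` on a morphism: `(▸f)_1` is the identity and `(▸f)_{n + 1} = f_n`. -/
def laterTreesMap {X Y : Trees.{u}} (f : X ⟶ Y) : ∀ n, laterTreesObj X n ⟶ laterTreesObj Y n
  | 0 => 𝟙 _
  | n + 1 => f.app (op n)

/-- The components of `next`: `next_1` is the map to `{⋆}`, and `next_{n + 1} : X(n + 1) → X(n)`
is the restriction map. -/
def nextTreesApp (X : Trees.{u}) : ∀ n, X.obj (op n) ⟶ laterTreesObj X n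
  | 0 => TypeCat.ofHom fun _ => PUnit.unit
  | n + 1 => X.map (homOfLE (Nat.le_succ n)).op

/-- The functor `▸` on the topos of trees. -/
def laterTrees : Trees.{u} ⥤ Trees.{u} where
  obj X := Functor.ofOpSequence (laterTreesRes X)
  map {X Y} f := NatTrans.ofOpSequence (laterTreesMap f) fun n => by
    rw [Functor.ofOpSequence_map_homOfLE_succ, Functor.ofOpSequence_map_homOfLE_succ]
    cases n with
    | zero => rfl
    | succ n => exact f.naturality _
  map_id X := by
    ext ⟨n⟩ x
    cases n <;> rfl
  map_comp f g := by
    ext ⟨n⟩ x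
    cases n <;> rfl

/-- The natural transformation `next` on the topos of trees. -/
def nextTrees : 𝟭 Trees.{u} ⟶ laterTrees where
  app X := NatTrans.ofOpSequence (nextTreesApp X) fun n => by
    change _ = _ ≫ (Functor.ofOpSequence (laterTreesRes X)).map _
    rw [Functor.ofOpSequence_map_homOfLE_succ]
    cases n <;> rfl
  naturality X Y f := by
    ext ⟨n⟩ x
    cases n with
    | zero => rfl
    | succ n => exact (NatTrans.naturality_apply f _ x).symm

end Trees

end GuardedRec

/-! All three cases follow from one abstract criterion, `StageSystem.modelsGuardedDependentTypes`.
Call a map an isomorphism at a subterminal object `U` if it becomes invertible after multiplying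
with `U`. A stage system is a well-founded family of subterminals `stage k`, jointly detecting
isomorphisms, with `pre k` the join of the earlier stages. The decisive axiom is `stage k ≤ ▸(pre
k)`: anything under `▸` is determined at stage `k` by what happens strictly before `k`.

Terms: the fixed points of `f ∘ next` form an equalizer inside `X`. By well-founded induction its
map to `1` is an isomorphism at every stage, hence an isomorphism, so it has exactly one global
element.

Types: a locally contractive `F` sends isomorphisms at `pre k` to isomorphisms at `stage k`, since
`▸` carries an internal inverse across `stage k ≤ ▸(pre k)` (`LocallyContractive.isoAt`). Iterate
`F` transfinitely from the initial object. At each stage the structure maps `X_j ⟶ F X_j` are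
eventually isomorphisms; along a regular cardinal exceeding the number of stages, some single `j`
works for all of them, and `F X_j ≅ X_j`.

Dependent types: a stage system on `E` pulls back to each slice, and the slices are cartesian closed
because they are equivalent to presheaf categories or are lex reflections of slices of presheaf
categories. -/

namespace GuardedRec

open Limits MonoidalCategory CartesianMonoidalCategory

universe w

/-! ### Stages, and unique guarded fixed points of terms. -/

section Stages

variable {E : Type u} [Category.{v} E]

/-- `f : X ⟶ Y` is an isomorphism at the stage `U`: every `T ⟶ Y` such that `T` maps to `U` factors
uniquely through `f`. -/
def IsoAt (U : E) {X Y : E} (f : X ⟶ Y) : Prop :=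
  ∀ T : E, Nonempty (T ⟶ U) → Function.Bijective (fun g : T ⟶ X => g ≫ f)

theorem IsoAt.of_isIso (U : E) {X Y : E} (f : X ⟶ Y) [IsIso f] : IsoAt U f := fun _ _ =>
  ⟨fun _ _ h => (cancel_mono f).1 h, fun g => ⟨g ≫ inv f, by simp⟩⟩

theorem IsoAt.comp {U X Y Z : E} {f : X ⟶ Y} {g : Y ⟶ Z} (hf : IsoAt U f) (hg : IsoAt U g) :
    IsoAt U (f ≫ g) := fun T t => by
  convert (hg T t).comp (hf T t) using 1
  funext a
  simp

theorem IsoAt.of_comp_left {U X Y Z : E} {f : X ⟶ Y} {g : Y ⟶ Z} (hf : IsoAt U f)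
    (hfg : IsoAt U (f ≫ g)) : IsoAt U g := fun T t => by
  refine (Function.Bijective.of_comp_iff _ (hf T t)).1 ?_
  convert hfg T t using 1
  funext a
  simp

/-- A well-founded system of stages for a functor `L`: subterminal objects `stage k`, indexed by a
well-founded preorder, together with subterminal objects `pre k` covered by the `stage j` for
`j < k`, such that `stage k ≤ L (pre k)`, and such that all `stage k` cover the terminal object. -/
structure StageSystem (L : E ⥤ E) (κ : Type w) [Preorder κ] where
  /-- the stages -/
  stage : κ → E
  /-- the joins of the preceding stages -/
  pre : κ → E
  stage_subsingleton (k : κ) (T : E) : Subsingleton (T ⟶ stage k)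
  pre_subsingleton (k : κ) (T : E) : Subsingleton (T ⟶ pre k)
  pre_le (k : κ) : Nonempty (pre k ⟶ stage k)
  stage_le_pre (k : κ) : Nonempty (stage k ⟶ L.obj (pre k))
  isoAt_pre (k : κ) {X Y : E} (f : X ⟶ Y) : (∀ j < k, IsoAt (stage j) f) → IsoAt (pre k) f
  isIso {X Y : E} (f : X ⟶ Y) : (∀ k, IsoAt (stage k) f) → IsIso f

variable {L : E ⥤ E} {κ : Type w} [Preorder κ]

theorem StageSystem.later_pre_subsingleton [HasFiniteLimits E] [PreservesFiniteLimits L]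
    (S : StageSystem L κ) (k : κ) (T : E) : Subsingleton (T ⟶ L.obj (S.pre k)) := by
  have : Mono (terminal.from (S.pre k)) := ⟨fun _ _ _ => (S.pre_subsingleton k _).elim _ _⟩
  have : Mono (L.map (terminal.from (S.pre k))) := inferInstance
  refine ⟨fun a b => (cancel_mono (L.map (terminal.from (S.pre k)))).1 ?_⟩
  exact (IsTerminal.isTerminalObj L _ terminalIsTerminal).hom_ext _ _

/-- Over stage `k`, `next` only sees the restriction to `pre k`: `▸(T ⨯ pre k)` is `▸T ⨯ ▸(pre k)`,
and `T` maps to the second factor through `stage k ≤ ▸(pre k)`. -/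
theorem StageSystem.exists_lift_next [HasFiniteLimits E] [PreservesFiniteLimits L]
    (S : StageSystem L κ) (next : 𝟭 E ⟶ L) (k : κ) {T : E} (t : T ⟶ S.stage k) :
    ∃ e : T ⟶ L.obj (T ⨯ S.pre k), e ≫ L.map prod.fst = next.app T := by
  obtain ⟨d⟩ := S.stage_le_pre k
  refine ⟨prod.lift (next.app T) (t ≫ d) ≫ (PreservesLimitPair.iso L T (S.pre k)).inv, ?_⟩
  rw [Category.assoc, PreservesLimitPair.iso_inv_fst, prod.lift_fst]

theorem StageSystem.modelsGuardedTerms [WellFoundedLT κ] [HasFiniteLimits E]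
    [PreservesFiniteLimits L] (S : StageSystem L κ) (next : 𝟭 E ⟶ L) :
    ModelsGuardedTerms L next where
  hasFiniteProducts := inferInstance
  preservesFiniteLimits := inferInstance
  existsUnique_fix T hT X f := by
    -- The equalizer is the object of fixed points. Being an isomorphism at stage `k` means having
    -- exactly one fixed point there; by induction this is known on `pre k`.
    have key : ∀ k, IsoAt (S.stage k) (hT.from (equalizer (next.app X ≫ f) (𝟙 X))) := by
      intro k
      induction k using WellFoundedLT.induction with
      | ind k ih =>
        have hpre := S.isoAt_pre k _ ih
        set i := equalizer.ι (next.app X ≫ f) (𝟙 X)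
        have hi : i ≫ next.app X ≫ f = i := by
          simpa using equalizer.condition (next.app X ≫ f) (𝟙 X)
        rintro R ⟨t⟩
        refine ⟨fun a b _ => ?_, fun c => ?_⟩
        · obtain ⟨e, he⟩ := S.exists_lift_next next k t
          have hab : (prod.fst : R ⨯ S.pre k ⟶ R) ≫ a = prod.fst ≫ b :=
            (hpre _ ⟨prod.snd⟩).1 (hT.hom_ext _ _)
          -- Unfolding a fixed point once puts it under `▸`, so it is recovered from its restriction
          -- to `pre k`. This gives uniqueness.
          have aux : ∀ c : R ⟶ equalizer (next.app X ≫ f) (𝟙 X),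
              c ≫ i = e ≫ L.map (prod.fst ≫ c) ≫ L.map i ≫ f := fun c => by
            rw [L.map_comp, Category.assoc, reassoc_of% he]
            have h1 := next.naturality (c ≫ i)
            simp only [Functor.id_map, L.map_comp, Category.assoc] at h1
            rw [← reassoc_of% h1, hi]
          apply equalizer.hom_ext
          change a ≫ i = b ≫ i
          rw [aux a, aux b, hab]
        -- Existence: `s` is the fixed point over `pre k`. Applying `▸` and then `f` extends it to
        -- `stage k`, by `d ≫ L.map (s ≫ i) ≫ f`.
        · obtain ⟨s, -⟩ := (hpre (S.pre k) ⟨𝟙 _⟩).2 (hT.from _)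
          obtain ⟨d⟩ := S.stage_le_pre k
          obtain ⟨m⟩ := S.pre_le k
          have hm : next.app (S.stage k) = d ≫ L.map m := by
            have := S.later_pre_subsingleton (T := S.stage k) k
            obtain ⟨e, he⟩ := S.exists_lift_next next k (𝟙 (S.stage k))
            rw [← he, (S.stage_subsingleton k _).elim
              (prod.fst : S.stage k ⨯ S.pre k ⟶ S.stage k) (prod.snd ≫ m), L.map_comp,
              ← Category.assoc]
            congr 1
            exact Subsingleton.elim _ _
          have hd : m ≫ d = next.app (S.pre k) := (S.later_pre_subsingleton k _).elim _ _
          have hs : next.app (S.pre k) ≫ L.map (s ≫ i) = s ≫ i ≫ next.app X := by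
            simpa using (next.naturality (s ≫ i)).symm
          have hy : (d ≫ L.map (s ≫ i) ≫ f) ≫ next.app X ≫ f = d ≫ L.map (s ≫ i) ≫ f := by
            have h1 := next.naturality (d ≫ L.map (s ≫ i) ≫ f)
            simp only [Functor.id_map] at h1
            rw [← Category.assoc, h1, hm, Category.assoc, Category.assoc, ← L.map_comp_assoc,
              reassoc_of% hd, reassoc_of% hs, hi]
          refine ⟨t ≫ equalizer.lift (d ≫ L.map (s ≫ i) ≫ f) (by simpa using hy),
            hT.hom_ext _ _⟩
    have := S.isIso _ key
    refine ⟨inv (hT.from (equalizer (next.app X ≫ f) (𝟙 X))) ≫ equalizer.ι _ _, ?_, ?_⟩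
    · simpa using (inv (hT.from _)) ≫= equalizer.condition (next.app X ≫ f) (𝟙 X)
    · intro h hh
      have : hT.from _ ≫ equalizer.lift h (by simpa using hh) =
        𝟙 (equalizer (next.app X ≫ f) (𝟙 X)) := by
        rw [← cancel_mono (hT.from (equalizer (next.app X ≫ f) (𝟙 X)))]
        exact hT.hom_ext _ _
      rw [IsIso.eq_inv_comp]
      simpa using this =≫ equalizer.ι _ _

end Stages

/-! ### Calculus of generalised elements of exponentials. -/

section Evaluation

variable {E : Type u} [Category.{v} E] [CartesianMonoidalCategory E] [MonoidalClosed E]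

/-- Evaluation of a generalised element `a` of `Y ^ X` at a generalised element `x` of `X`. -/
def evalAt {T X Y : E} (x : T ⟶ X) (a : T ⟶ (ihom X).obj Y) : T ⟶ Y :=
  lift x a ≫ (ihom.ev X).app Y

theorem evalAt_curry {T A X Y : E} (x : T ⟶ X) (t : T ⟶ A) (g : X ⊗ A ⟶ Y) :
    evalAt x (t ≫ MonoidalClosed.curry g) = lift x t ≫ g := by
  have : lift x (t ≫ MonoidalClosed.curry g) = lift x t ≫ X ◁ MonoidalClosed.curry g := by simp
  rw [evalAt, this, Category.assoc, MonoidalClosed.whiskerLeft_curry_ihom_ev_app]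

theorem evalAt_curry' {T X Y : E} (x : T ⟶ X) (f : X ⟶ Y) :
    evalAt x (toUnit T ≫ MonoidalClosed.curry' f) = x ≫ f := by
  rw [MonoidalClosed.curry', evalAt_curry]
  simp

theorem evalAt_comp {T X Y Z : E} (x : T ⟶ X) (a : T ⟶ (ihom X).obj Y)
    (b : T ⟶ (ihom Y).obj Z) :
    evalAt x (lift a b ≫ MonoidalClosed.comp X Y Z) = evalAt (evalAt x a) b := by
  rw [MonoidalClosed.comp_eq, evalAt_curry, MonoidalClosed.compTranspose_eq]
  have : lift x (lift a b) ≫ (α_ X _ _).inv = lift (lift x a) b := by simp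
  rw [reassoc_of% this]
  simp [evalAt]

theorem hom_ext_evalAt {T X Y : E} {a b : T ⟶ (ihom X).obj Y}
    (h : evalAt (fst X T) (snd X T ≫ a) = evalAt (fst X T) (snd X T ≫ b)) : a = b := by
  apply MonoidalClosed.uncurry_injective
  have aux : ∀ c : T ⟶ (ihom X).obj Y, MonoidalClosed.uncurry c =
      evalAt (fst X T) (snd X T ≫ c) := fun c => by
    rw [MonoidalClosed.uncurry_eq, evalAt]
    congr 1
    ext <;> simp
  rw [aux, aux, h]

end Evaluation

/-! ### Locally contractive functors gain one stage. -/

section Contractive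

variable {E : Type u} [Category.{v} E] [CartesianMonoidalCategory E] [MonoidalClosed E]

/-- An inverse at the stage `U`, given as an element of the exponential. -/
theorem IsoAt.of_inverse {U X Y : E} {f : X ⟶ Y} (g : U ⟶ (ihom Y).obj X)
    (h₁ : lift g (toUnit U ≫ MonoidalClosed.curry' f) ≫ MonoidalClosed.comp Y X Y =
      toUnit U ≫ MonoidalClosed.id Y)
    (h₂ : lift (toUnit U ≫ MonoidalClosed.curry' f) g ≫ MonoidalClosed.comp X Y X =
      toUnit U ≫ MonoidalClosed.id X) : IsoAt U f := by
  rintro T ⟨t⟩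
  refine Function.bijective_iff_has_inverse.2 ⟨fun y => evalAt y (t ≫ g), fun x => ?_, fun y => ?_⟩
  · have h := congrArg (fun a => evalAt x (t ≫ a)) h₂
    simp only [← Category.assoc, comp_lift, comp_toUnit, evalAt_comp, evalAt_curry',
      ← MonoidalClosed.curry'_id, Category.comp_id] at h
    exact h
  · have h := congrArg (fun a => evalAt y (t ≫ a)) h₁
    simp only [← Category.assoc, comp_lift, comp_toUnit, evalAt_comp, evalAt_curry',
      ← MonoidalClosed.curry'_id, Category.comp_id] at h
    exact h

theorem IsoAt.exists_inverse {U X Y : E} {f : X ⟶ Y} (hf : IsoAt U f) :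
    ∃ g : U ⟶ (ihom Y).obj X,
      lift g (toUnit U ≫ MonoidalClosed.curry' f) ≫ MonoidalClosed.comp Y X Y =
        toUnit U ≫ MonoidalClosed.id Y ∧
      lift (toUnit U ≫ MonoidalClosed.curry' f) g ≫ MonoidalClosed.comp X Y X =
        toUnit U ≫ MonoidalClosed.id X := by
  -- Lifting the generic element of `Y` over `U` gives the inverse in parametrised form; currying
  -- makes it an element of the exponential.
  obtain ⟨g, hg⟩ := (hf (Y ⊗ U) ⟨snd _ _⟩).2 (fst Y U)
  refine ⟨MonoidalClosed.curry g, hom_ext_evalAt ?_, hom_ext_evalAt ?_⟩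
  · simp only [← Category.assoc, comp_lift, comp_toUnit, evalAt_comp, evalAt_curry',
      evalAt_curry, ← MonoidalClosed.curry'_id, Category.comp_id]
    simpa using hg
  · simp only [← Category.assoc, comp_lift, comp_toUnit, evalAt_comp, evalAt_curry',
      evalAt_curry, ← MonoidalClosed.curry'_id, Category.comp_id]
    apply (hf (X ⊗ U) ⟨snd _ _⟩).1
    simp only [Category.assoc] at hg ⊢
    rw [hg]
    simp

/-- The inverse of `f` over `V` is an element of `X ^ Y`. Its image under `▸`, restricted along `d`
and followed by `G`, is an inverse of `F f` over `U`, because `G` respects names, identities and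
composition. -/
theorem LocallyContractive.isoAt {L : E ⥤ E} [PreservesFiniteLimits L] {next : 𝟭 E ⟶ L}
    {F : E ⥤ E} (hF : LocallyContractive L next F) {U V : E} (d : U ⟶ L.obj V)
    {X Y : E} {f : X ⟶ Y} (hf : IsoAt V f) : IsoAt U (F.map f) := by
  obtain ⟨G, hname, hid, hcomp⟩ := hF
  obtain ⟨g, h₁, h₂⟩ := hf.exists_inverse
  -- Constant elements pass through `▸` as their composite with `next`, because `▸1` is terminal.
  have hL : ∀ {A B : E} (b : 𝟙_ E ⟶ B) (a : L.obj B ⟶ A),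
      d ≫ L.map (toUnit V ≫ b) ≫ a = toUnit U ≫ b ≫ next.app B ≫ a := fun b a => by
    have h : next.app (𝟙_ E) ≫ L.map b = b ≫ next.app _ := (next.naturality b).symm
    have hT : d ≫ L.map (toUnit V) = toUnit U ≫ next.app (𝟙_ E) :=
      (IsTerminal.isTerminalObj L _ isTerminalTensorUnit).hom_ext _ _
    rw [L.map_comp, Category.assoc, reassoc_of% hT, reassoc_of% h]
  have hpair : ∀ {A B C : E} (a : V ⟶ (ihom A).obj B) (b : V ⟶ (ihom B).obj C),
      d ≫ L.map (lift a b ≫ MonoidalClosed.comp A B C) ≫ G A C =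
        lift (d ≫ L.map a ≫ G A B) (d ≫ L.map b ≫ G B C) ≫
          MonoidalClosed.comp (F.obj A) (F.obj B) (F.obj C) := fun {A B C} a b => by
    rw [L.map_comp, Category.assoc, hcomp]
    simp only [← Category.assoc]
    congr 1
    ext <;> simp [← L.map_comp_assoc]
  refine IsoAt.of_inverse (d ≫ L.map g ≫ G Y X) ?_ ?_
  · rw [← hid, ← hL, ← h₁, hpair, hL, hname]
  · rw [← hid, ← hL, ← h₂, hpair, hL, hname]

end Contractive

/-! ### Colimits of coalgebras, which carry the structure maps of the chain through limit steps. -/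

section Coalgebras

variable {E : Type u} [Category.{v} E] (F : E ⥤ E)

open Endofunctor

variable {F} in
theorem coalgebra_square_ext {A B C : E} {a : A ⟶ B} {σ : B ⟶ F.obj B} {δ : A ⟶ F.obj A}
    {m : B ⟶ C} {τ : C ⟶ F.obj C} {q : A ⟶ C} (h : a ≫ σ = δ ≫ F.map a)
    (hq : δ ≫ F.map q = q ≫ τ) (hm : a ≫ m = q) : a ≫ σ ≫ F.map m = a ≫ m ≫ τ := by
  subst hm
  rw [reassoc_of% h, ← F.map_comp, hq, Category.assoc]

/-- The structure maps of coalgebras, as a natural transformation. -/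
def coalgebraStr : Coalgebra.forget F ⟶ Coalgebra.forget F ⋙ F where
  app X := X.str
  naturality _ _ f := f.h.symm

section

variable {F} {J : Type*} [Category* J] (D : J ⥤ Coalgebra F)

/-- The coalgebra structure on a colimit of the underlying objects of coalgebras. -/
def coalgebraOfIsColimit {c : Cocone (D ⋙ Coalgebra.forget F)} (hc : IsColimit c) :
    Coalgebra F where
  V := c.pt
  str := hc.desc ((Cocone.precompose (Functor.whiskerLeft D (coalgebraStr F))).obj
    (F.mapCocone c))

variable {D} {c : Cocone (D ⋙ Coalgebra.forget F)} (hc : IsColimit c)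

theorem ι_coalgebraOfIsColimit_str (j : J) :
    c.ι.app j ≫ (coalgebraOfIsColimit D hc).str = (D.obj j).str ≫ F.map (c.ι.app j) :=
  hc.fac _ j

/-- The cocone of coalgebras on a colimit of the underlying objects. -/
def coalgebraCocone : Cocone D where
  pt := coalgebraOfIsColimit D hc
  ι :=
    { app j := { f := c.ι.app j, h := (ι_coalgebraOfIsColimit_str hc j).symm }
      naturality _ _ f := Coalgebra.Hom.ext (c.ι.naturality f) }

/-- `coalgebraCocone` is a colimit cocone. -/
def isColimitCoalgebraCocone : IsColimit (coalgebraCocone hc) where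
  desc s :=
    let m : c.pt ⟶ s.pt.V := hc.desc ((Coalgebra.forget F).mapCocone s)
    { f := m
      h := hc.hom_ext fun j =>
        coalgebra_square_ext (ι_coalgebraOfIsColimit_str hc j) (s.ι.app j).h (hc.fac _ j) }
  fac _ j := Coalgebra.Hom.ext (hc.fac _ j)
  uniq s _ hm := Coalgebra.Hom.ext <| hc.uniq ((Coalgebra.forget F).mapCocone s) _ fun j =>
    congrArg Coalgebra.Hom.f (hm j)

end

instance coalgebra_hasColimitsOfShape (J : Type*) [Category* J] [HasColimitsOfShape J E] :
    HasColimitsOfShape J (Coalgebra F) :=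
  ⟨fun _ => ⟨⟨_, isColimitCoalgebraCocone (colimit.isColimit _)⟩⟩⟩

instance coalgebra_hasColimitsOfSize [HasColimitsOfSize.{w, w} E] :
    HasColimitsOfSize.{w, w} (Coalgebra F) where

instance coalgebra_forget_preservesColimitsOfShape (J : Type*) [Category* J]
    [HasColimitsOfShape J E] : PreservesColimitsOfShape J (Coalgebra.forget F) :=
  ⟨fun {D} => preservesColimit_of_preserves_colimit_cocone
    (isColimitCoalgebraCocone (colimit.isColimit (D ⋙ Coalgebra.forget F)))
    (IsColimit.ofIsoColimit (colimit.isColimit (D ⋙ Coalgebra.forget F))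
      (Cocone.ext (Iso.refl _) fun j => Category.comp_id ((colimit.cocone _).ι.app j)))⟩

instance coalgebra_forget_preservesColimitsOfSize [HasColimitsOfSize.{w, w} E] :
    PreservesColimitsOfSize.{w, w} (Coalgebra.forget F) where

/-- The successor structure on coalgebras that applies `F` to the structure map. -/
noncomputable def coalgebraSucc [HasInitial E] : SmallObject.SuccStruct (Coalgebra F) where
  X₀ := ⟨⊥_ E, initial.to _⟩
  succ X := ⟨F.obj X.V, F.map X.str⟩
  toSucc X := ⟨X.str, rfl⟩

end Coalgebras

/-! ### The transfinite iteration of `F` and its stabilisation. -/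

section Chain

open SmallObject Endofunctor

variable {E : Type u} [Category.{v} E] [CartesianMonoidalCategory E]

/-- In this form colimits can be used: `U ⊗ -` is a left adjoint, so isomorphisms at `U` are closed
under transfinite composition. -/
theorem IsoAt.iff_isIso_whiskerLeft {U X Y : E} (f : X ⟶ Y) : IsoAt U f ↔ IsIso (U ◁ f) := by
  constructor
  · intro h
    obtain ⟨g, hg⟩ := (h (U ⊗ Y) ⟨fst _ _⟩).2 (snd _ _)
    refine ⟨lift (fst _ _) g, ?_, ?_⟩
    · ext
      · simp
      · simp only [Category.assoc, lift_snd, Category.id_comp]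
        refine (h (U ⊗ X) ⟨fst _ _⟩).1 ?_
        simp only [Category.assoc] at hg ⊢
        rw [hg, whiskerLeft_snd]
    · ext
      · simp
      · simpa using hg
  · rintro h T ⟨t⟩
    refine ⟨fun a b hab => ?_, fun y => ⟨lift t y ≫ inv (U ◁ f) ≫ snd _ _, ?_⟩⟩
    · have : lift t a ≫ U ◁ f = lift t b ≫ U ◁ f := by simpa using congrArg (lift t) hab
      simpa using ((cancel_mono _).1 this) =≫ snd _ _
    · have : inv (U ◁ f) ≫ snd U X ≫ f = snd _ _ := by
        rw [IsIso.inv_comp_eq, whiskerLeft_snd]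
      simp [this]

variable [MonoidalClosed E] {L : E ⥤ E} {κ : Type w} [Preorder κ] [WellFoundedLT κ]

/-- The successor steps of the chain are, up to isomorphism, the structure maps, and the transition
map from `s` to `b` is their transfinite composite. -/
theorem isoAt_iterationFunctor_map {U : E} {F : E ⥤ E} (Φ : SuccStruct (Coalgebra F))
    {J : Type w} [LinearOrder J] [OrderBot J] [SuccOrder J] [WellFoundedLT J]
    [HasColimitsOfSize.{w, w} E] {s b : J} (hsb : s ≤ b)
    (h : ∀ i, s ≤ i → i < b → IsoAt U (Φ.toSucc ((Φ.iterationFunctor J).obj i)).f) :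
    IsoAt U ((Φ.iterationFunctor J).map (homOfLE hsb)).f := by
  let W : MorphismProperty (Coalgebra F) :=
    (MorphismProperty.isomorphisms E).inverseImage (Coalgebra.forget F ⋙ tensorLeft U)
  have hW : ∀ {X Y : Coalgebra F} (f : X ⟶ Y), IsoAt U f.f ↔ W f := fun f =>
    IsoAt.iff_isIso_whiskerLeft f.f
  have hstep : ∀ i j (hij : i ≤ j), s ≤ i → i < b → j = Order.succ i →
      W ((Φ.iterationFunctor J).map (homOfLE hij)) := by
    rintro i _ hij hi hib rfl
    rw [Φ.iterationFunctor_map_succ i (not_isMax_of_lt hib), ← hW]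
    have : IsIso (Φ.iterationFunctorObjSuccIso i (not_isMax_of_lt hib)).inv.f :=
      inferInstanceAs (IsIso ((Coalgebra.forget F).map _))
    exact (h i hi hib).comp (IsoAt.of_isIso _ _)
  let t := ((Φ.transfiniteCompositionOfShapeιIteration J).iic b).ici ⟨s, hsb⟩
  let t' : W.TransfiniteCompositionOfShape (Set.Ici (⟨s, hsb⟩ : Set.Iic b))
      ((Φ.iterationFunctor J).map (homOfLE hsb)) :=
    { t.toTransfiniteCompositionOfShape with
      map_mem := fun l hl => by
        have hl' : ¬ IsMax l.1 := Set.not_isMax_coe _ hl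
        have hlb : l.1.1 < b := by
          obtain ⟨m, hm⟩ := not_isMax_iff.1 hl'
          exact lt_of_lt_of_le (show l.1.1 < m.1 from hm) m.2
        refine hstep l.1.1 (Order.succ l).1.1 (Order.le_succ l) l.2 hlb ?_
        have h₁ : (Order.succ l).1 = Order.succ l.1 := by
          have hmem : Order.succ l.1 ∈ Set.Ici (⟨s, hsb⟩ : Set.Iic b) :=
            le_trans (b := l.1) l.2 (Order.le_succ l.1)
          exact coe_succ_of_mem hmem
        rw [h₁, Set.Iic.coe_succ_of_not_isMax hl'] }
  have : PreservesColimitsOfSize.{w, w} (tensorLeft U) :=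
    (ihom.adjunction U).leftAdjoint_preservesColimits
  have : PreservesWellOrderContinuousOfShape (Set.Ici (⟨s, hsb⟩ : Set.Iic b))
      (Coalgebra.forget F ⋙ tensorLeft U) := ⟨fun _ _ => inferInstance⟩
  exact (hW _).2 (t'.map (F := Coalgebra.forget F ⋙ tensorLeft U)).isIso

theorem StageSystem.exists_fixedPoint [HasColimitsOfSize.{w, w} E] (S : StageSystem L κ)
    (F : E ⥤ E) (hF : ∀ (k : κ) {X Y : E} (f : X ⟶ Y), IsoAt (S.pre k) f →
      IsoAt (S.stage k) (F.map f)) : ∃ X : E, Nonempty (F.obj X ≅ X) := by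
  -- By regularity, any `κ`-indexed family of positions in the chain is bounded.
  obtain ⟨c, hc, hκ⟩ : ∃ c : Cardinal.{w}, c.IsRegular ∧ Cardinal.mk κ < c :=
    ⟨Order.succ (max Cardinal.aleph0 (Cardinal.mk κ)),
      Cardinal.isRegular_succ (le_max_left _ _), Order.lt_succ_of_le (le_max_right _ _)⟩
  have : Fact c.IsRegular := ⟨hc⟩
  have hJ : Nonempty c.ord.ToType := by simpa using hc.ne_zero
  have : NoMaxOrder c.ord.ToType := Cardinal.noMaxOrder hc.aleph0_le
  let : OrderBot c.ord.ToType := WellFoundedLT.toOrderBot _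
  have bound : ∀ g : κ → c.ord.ToType, ∃ j, ∀ k, g k ≤ j := fun g =>
    ⟨IsCardinalFiltered.max g (κ := c) (by rwa [hasCardinalLT_iff_cardinal_mk_lt]), fun k =>
      leOfHom (IsCardinalFiltered.toMax g _ k)⟩
  have : HasInitial E :=
    hasColimitsOfShape_of_equivalence (Discrete.equivalence (Equiv.equivPEmpty PEmpty.{w + 1}))
  let Φ := coalgebraSucc F
  let X := Φ.iterationFunctor c.ord.ToType
  have key : ∀ k, ∃ i : c.ord.ToType, ∀ j, i ≤ j → IsoAt (S.stage k) (X.obj j).str := by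
    intro k
    induction k using WellFoundedLT.induction with
    | ind k ih =>
      have : ∃ i : c.ord.ToType, ∀ l < k, ∀ j, i ≤ j → IsoAt (S.stage l) (X.obj j).str := by
        -- Values of `g` outside `l < k` are arbitrary, which is harmless: `bound` dominates them
        -- too.
        choose! g hg using ih
        obtain ⟨i, hi⟩ := bound g
        exact ⟨i, fun l hl j hj => hg l hl j ((hi l).trans hj)⟩
      obtain ⟨i, hi⟩ := this
      -- Beyond `i` the transition maps are isomorphisms at all earlier stages, hence at `pre k`;
      -- `F` improves this to stage `k`.
      have hmap : ∀ a b (hab : a ≤ b), i ≤ a →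
          IsoAt (S.stage k) (F.map (X.map (homOfLE hab)).f) := fun a b hab ha =>
        hF k _ <| S.isoAt_pre k _ fun l hl => isoAt_iterationFunctor_map Φ hab fun j hj _ =>
          hi l hl j (ha.trans hj)
      have hsucc : IsoAt (S.stage k) (X.obj (Order.succ i)).str := by
        let e : X.obj (Order.succ i) ≅ Φ.succ (X.obj i) :=
          Φ.iterationFunctorObjSuccIso i (not_isMax i)
        have : IsIso e.inv.f := inferInstanceAs (IsIso ((Coalgebra.forget F).map e.inv))
        have hstr : IsoAt (S.stage k) (Φ.succ (X.obj i)).str :=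
          hF k _ (S.isoAt_pre k _ fun l hl => hi l hl i le_rfl)
        refine (IsoAt.of_isIso _ e.inv.f).of_comp_left ?_
        rw [← e.inv.h]
        exact hstr.comp (IsoAt.of_isIso _ (F.map e.inv.f))
      -- A second induction, along the chain: structure maps before `b` make the transition map from
      -- `Order.succ i` to `b` an isomorphism at stage `k`. The coalgebra square for that map then
      -- yields the structure map at `b` by cancellation.
      refine ⟨Order.succ i, fun b => ?_⟩
      induction b using WellFoundedLT.induction with
      | ind b ihb =>
        intro hb
        have ht : IsoAt (S.stage k) (X.map (homOfLE hb)).f :=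
          isoAt_iterationFunctor_map Φ hb fun j hj hjb => ihb j hjb hj
        refine ht.of_comp_left ?_
        rw [← (X.map (homOfLE hb)).h]
        exact hsucc.comp (hmap _ _ hb (Order.le_succ i))
  choose g hg using key
  obtain ⟨j, hj⟩ := bound g
  have := S.isIso (X.obj j).str fun k => hg k j (hj k)
  exact ⟨(X.obj j).V, ⟨(asIso (X.obj j).str).symm⟩⟩

end Chain

/-! ### Stage systems on slices. -/

section Slices

variable {E : Type u} [Category.{v} E]

/-- A map over `I` into `I^* U` is just a map from the domain to `U`, and any test object over `Y`
acquires its map to `I` from `Y`. -/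
theorem isoAt_star_iff [HasBinaryProducts E] {I : E} (U : E) {X Y : Over I} (f : X ⟶ Y) :
    IsoAt ((Over.star I).obj U) f ↔ IsoAt U f.left := by
  constructor
  · rintro h T ⟨t⟩
    refine ⟨fun a b hab => ?_, fun y => ?_⟩
    · let R : Over I := Over.mk (a ≫ X.hom)
      have hb : b ≫ X.hom = a ≫ X.hom := by
        have := congrArg (· ≫ Y.hom) hab
        simpa using this.symm
      have : (Over.homMk a : R ⟶ X) = Over.homMk b hb := by
        refine (h R ⟨(Over.forgetAdjStar I).homEquiv _ _ t⟩).1 ?_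
        ext
        exact hab
      exact congrArg CommaMorphism.left this
    · let R : Over I := Over.mk (y ≫ Y.hom)
      obtain ⟨x, hx⟩ := (h R ⟨(Over.forgetAdjStar I).homEquiv _ _ t⟩).2 (Over.homMk y)
      exact ⟨x.left, congrArg CommaMorphism.left hx⟩
  · rintro h T ⟨t⟩
    have h' := h T.left ⟨((Over.forgetAdjStar I).homEquiv _ _).symm t⟩
    refine ⟨fun a b hab => ?_, fun y => ?_⟩
    · ext
      exact h'.1 (congrArg CommaMorphism.left hab)
    · obtain ⟨x, hx⟩ := h'.2 y.left
      refine ⟨Over.homMk x ?_, ?_⟩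
      · rw [← Over.w y, ← Over.w f, ← Category.assoc]
        exact congrArg (· ≫ Y.hom) hx
      · ext
        exact hx

instance post_preservesFiniteLimits {D : Type*} [Category* D] [HasFiniteLimits E]
    [HasFiniteLimits D] (L : E ⥤ D) [PreservesFiniteLimits L] (I : E) :
    PreservesFiniteLimits (Over.post (X := I) L) := by
  have : PreservesLimitsOfShape (Discrete PEmpty.{1}) (Over.post (X := I) L) := by
    apply preservesLimitsOfShape_pempty_of_preservesTerminal
  have : PreservesLimitsOfShape WalkingCospan (Over.post (X := I) L) := by
    have : PreservesLimitsOfShape WalkingCospan (Over.post (X := I) L ⋙ Over.forget _) :=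
      inferInstanceAs (PreservesLimitsOfShape WalkingCospan (Over.forget I ⋙ L))
    exact preservesLimitsOfShape_of_reflects_of_preserves _ (Over.forget _)
  exact preservesFiniteLimits_of_preservesTerminal_and_pullbacks _

variable [HasFiniteLimits E] {L : E ⥤ E} [PreservesFiniteLimits L] (next : 𝟭 E ⟶ L)

instance laterOver_preservesFiniteLimits (I : E) :
    PreservesFiniteLimits (laterOver L next I) :=
  comp_preservesFiniteLimits _ _

variable {κ : Type w} [Preorder κ]

/-- The system of stages of a slice category. -/
noncomputable def StageSystem.over (S : StageSystem L κ) (I : E) :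
    StageSystem (laterOver L next I) κ where
  stage k := (Over.star I).obj (S.stage k)
  pre k := (Over.star I).obj (S.pre k)
  stage_subsingleton k T :=
    have : Subsingleton ((Over.forget I).obj T ⟶ S.stage k) := S.stage_subsingleton k T.left
    ((Over.forgetAdjStar I).homEquiv _ _).symm.subsingleton
  pre_subsingleton k T :=
    have : Subsingleton ((Over.forget I).obj T ⟶ S.pre k) := S.pre_subsingleton k T.left
    ((Over.forgetAdjStar I).homEquiv _ _).symm.subsingleton
  pre_le k := (S.pre_le k).map (Over.star I).map
  stage_le_pre k := by
    set U := (Over.star I).obj (S.stage k)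
    set V := (Over.star I).obj (S.pre k)
    -- A map into `▸_I V` is a map to `▸V` lying over `next_I`. Mapping to `▸(pre k)` alone loses
    -- the base point; lifting `next` itself retains it.
    obtain ⟨e, he⟩ := S.exists_lift_next (T := U.left) next k
      ((Over.forgetAdjStar I).counit.app (S.stage k))
    let r : Over.mk (prod.fst ≫ U.hom : U.left ⨯ S.pre k ⟶ I) ⟶ V :=
      (Over.forgetAdjStar I).homEquiv _ _ prod.snd
    have hr : r.left ≫ V.hom = prod.fst ≫ U.hom := Over.w r
    refine ⟨Over.homMk (pullback.lift (f := L.map V.hom) (g := next.app I)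
      (e ≫ L.map r.left) U.hom ?_) (pullback.lift_snd (f := L.map V.hom) (g := next.app I) _ _ _)⟩
    rw [Category.assoc, ← L.map_comp, hr, L.map_comp]
    have h := next.naturality U.hom
    rw [Functor.id_map] at h
    rw [h, ← Category.assoc]
    exact congrArg (· ≫ L.map U.hom) he
  isoAt_pre k X Y f h := by
    rw [isoAt_star_iff]
    exact S.isoAt_pre k _ fun j hj => (isoAt_star_iff _ f).1 (h j hj)
  isIso f h := by
    have : IsIso ((Over.forget I).map f) := S.isIso _ fun k => (isoAt_star_iff _ f).1 (h k)
    exact isIso_of_reflects_iso f (Over.forget I)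

end Slices

/-- `E` admits the structure of a cartesian closed category. -/
def HasCartesianClosed (E : Type u) [Category.{v} E] : Prop :=
  ∃ _ : CartesianMonoidalCategory E, Nonempty (MonoidalClosed E)

section

variable {E : Type u} [Category.{v} E] {L : E ⥤ E}
  [PreservesFiniteLimits L] (next : 𝟭 E ⟶ L) {κ : Type w} [Preorder κ] [WellFoundedLT κ]

theorem StageSystem.modelsGuardedTypes [HasFiniteLimits E] [HasColimitsOfSize.{w, w} E]
    (S : StageSystem L κ) (hE : HasCartesianClosed E) : ModelsGuardedTypes L next where
  toModelsGuardedTerms := S.modelsGuardedTerms next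
  cartesianClosed := hE
  exists_fixedPoint F hF := S.exists_fixedPoint F fun k _ _ _ hf =>
    (S.stage_le_pre k).elim fun d => hF.isoAt d hf

theorem StageSystem.modelsGuardedDependentTypes [HasFiniteLimits E] [HasColimitsOfSize.{w, w} E]
    (S : StageSystem L κ) (hE : ∀ I : E, HasCartesianClosed (Over I)) :
    ModelsGuardedDependentTypes L next where
  terms := S.modelsGuardedTerms next
  slice I :=
    have : HasColimitsOfSize.{w, w} (Over I) := ⟨fun _ _ => inferInstance⟩
    (S.over next I).modelsGuardedTypes _ (hE I)

end

/-! ### Cartesian closure of slices. -/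

section CartesianClosed

universe u₁ u₂

variable {C : Type u₁} [Category.{v} C] {D : Type u₂} [Category.{v} D]

theorem HasCartesianClosed.of_equivalence (e : C ≌ D) (h : HasCartesianClosed C) :
    HasCartesianClosed D := by
  obtain ⟨_, ⟨_⟩⟩ := h
  have : HasFiniteProducts D :=
    ⟨fun _ => Adjunction.hasLimitsOfShape_of_equivalence e.inverse⟩
  let _ : CartesianMonoidalCategory D := .ofHasFiniteProducts
  exact ⟨inferInstance, ⟨cartesianClosedOfEquiv e⟩⟩

theorem HasCartesianClosed.of_reflective (i : D ⥤ C) [Reflective i]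
    [PreservesFiniteLimits (reflector i)] (h : HasCartesianClosed C) : HasCartesianClosed D := by
  obtain ⟨_, ⟨_⟩⟩ := h
  let _ : CartesianMonoidalCategory D := .ofReflective i
  exact ⟨inferInstance, ⟨cartesianClosedOfReflective i⟩⟩

theorem hasCartesianClosed_over_presheaf {C : Type u} [SmallCategory C] (I : Cᵒᵖ ⥤ Type u) :
    HasCartesianClosed (Over I) :=
  HasCartesianClosed.of_equivalence (overEquivPresheafCostructuredArrow I).symm
    ⟨inferInstance, ⟨inferInstance⟩⟩

/-- A lex reflection induces a lex reflection on slices: reflect, then compose with the counit at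
`I`, which is invertible. Exponentials descend along such a reflection. -/
theorem HasCartesianClosed.over_of_reflective [HasFiniteLimits C] [HasFiniteLimits D] (i : D ⥤ C)
    [Reflective i] [PreservesFiniteLimits (reflector i)] (I : D)
    (h : HasCartesianClosed (Over (i.obj I))) : HasCartesianClosed (Over I) := by
  let R : Over (i.obj I) ⥤ Over I :=
    Over.post (reflector i) ⋙ Over.map ((reflectorAdjunction i).counit.app I)
  let adj : R ⊣ Over.post (X := I) i := Over.postAdjunctionRight (reflectorAdjunction i)
  let _ : Reflective (Over.post (X := I) i) := { L := R, adj := adj }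
  have : (Over.map ((reflectorAdjunction i).counit.app I)).IsEquivalence :=
    (Over.mapIso (asIso ((reflectorAdjunction i).counit.app I))).isEquivalence_functor
  have : PreservesFiniteLimits (reflector (Over.post (X := I) i)) :=
    comp_preservesFiniteLimits (Over.post (reflector i)) (Over.map _)
  exact h.of_reflective (Over.post (X := I) i)

theorem hasCartesianClosed_over_sheaf {C : Type u} [SmallCategory C] (J : GrothendieckTopology C)
    (I : Sheaf J (Type u)) : HasCartesianClosed (Over I) :=
  have : PreservesFiniteLimits (reflector (sheafToPresheaf J (Type u))) :=
    inferInstanceAs (PreservesFiniteLimits (presheafToSheaf J (Type u)))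
  HasCartesianClosed.over_of_reflective (sheafToPresheaf J (Type u)) I
    (hasCartesianClosed_over_presheaf _)

theorem hasCartesianClosed_over_trees (I : Trees.{u}) : HasCartesianClosed (Over I) :=
  -- The presheaf lemma needs its index category in universe `u`.
  let e : Trees.{u} ≌ ((ULift.{u} ℕ)ᵒᵖ ⥤ Type u) :=
    (ULift.orderIso.symm : ℕ ≃o ULift.{u} ℕ).equivalence.op.congrLeft
  HasCartesianClosed.of_equivalence (Over.postEquiv I e).symm (hasCartesianClosed_over_presheaf _)

end CartesianClosed

/-! ### Presheaves on preorders, with principal lower sets as stages. -/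

section LowerSets

open Opposite

variable {C : Type v} [Preorder C]

/-- The subterminal presheaf of a lower set. -/
def lowerPresheaf (s : LowerSet C) : Cᵒᵖ ⥤ Type w where
  obj c := ULift (PLift (c.unop ∈ s))
  map f := TypeCat.ofHom fun x => ⟨⟨s.lower (leOfHom f.unop) x.down.down⟩⟩

instance (s : LowerSet C) (c : Cᵒᵖ) : Subsingleton ((lowerPresheaf.{v, w} s).obj c) :=
  inferInstanceAs (Subsingleton (ULift (PLift _)))

instance (s : LowerSet C) (T : Cᵒᵖ ⥤ Type w) : Subsingleton (T ⟶ lowerPresheaf s) :=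
  ⟨fun _ _ => by ext; exact Subsingleton.elim _ _⟩

/-- The inclusion of lower sets, as a map of presheaves. -/
def lowerPresheafMap {s t : LowerSet C} (h : s ≤ t) :
    lowerPresheaf.{v, w} s ⟶ lowerPresheaf t where
  app _ := TypeCat.ofHom fun x => ⟨⟨h x.down.down⟩⟩

/-- The map from a principal lower set that is determined by an element of a presheaf. -/
def ofElement {X : Cᵒᵖ ⥤ Type w} {c : C} (x : X.obj (op c)) :
    lowerPresheaf (LowerSet.Iic c) ⟶ X where
  app _ := TypeCat.ofHom fun h => X.map (homOfLE h.down.down).op x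
  naturality _ _ f := by
    ext h
    exact Functor.map_comp_apply X (homOfLE h.down.down).op f x

theorem ofElement_app {X : Cᵒᵖ ⥤ Type w} {c : C} (x : X.obj (op c)) :
    (ofElement x).app (op c) ⟨⟨le_rfl⟩⟩ = x :=
  Functor.map_id_apply X _ x

theorem ofElement_comp {X Y : Cᵒᵖ ⥤ Type w} {c : C} (x : X.obj (op c)) (f : X ⟶ Y) :
    ofElement x ≫ f = ofElement (f.app (op c) x) := by
  ext d h
  exact NatTrans.naturality_apply f _ x

theorem bijective_app_of_bijective_comp {X Y : Cᵒᵖ ⥤ Type w} {f : X ⟶ Y} {c : C}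
    (h : Function.Bijective fun g : lowerPresheaf (LowerSet.Iic c) ⟶ X => g ≫ f) :
    Function.Bijective (f.app (op c)) := by
  refine ⟨fun a b hab => ?_, fun y => ?_⟩
  · have : ofElement a = ofElement b := h.1 (by simp only [ofElement_comp, hab])
    rw [← ofElement_app a, this, ofElement_app]
  · obtain ⟨g, hg⟩ := h.2 (ofElement y)
    refine ⟨g.app (op c) ⟨⟨le_rfl⟩⟩, ?_⟩
    rw [← ofElement_app y, ← hg]
    rfl

/-- A presheaf mapping to the subterminal of `s` is empty outside `s`, so lifts need only be chosen
where `f` is bijective; injectivity makes the choice natural. -/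
theorem isoAt_lowerPresheaf {X Y : Cᵒᵖ ⥤ Type w} {f : X ⟶ Y} {s : LowerSet C}
    (h : ∀ c ∈ s, Function.Bijective (f.app (op c))) : IsoAt (lowerPresheaf s) f := by
  rintro T ⟨t⟩
  have ht : ∀ c, T.obj c → Function.Bijective (f.app c) := fun c τ =>
    h c.unop (t.app c τ).down.down
  refine ⟨fun a b hab => ?_, fun y => ?_⟩
  · ext c τ
    exact (ht c τ).1 (congr($(hab).app c τ))
  · choose g hg using fun c (τ : T.obj c) => (ht c τ).2 (y.app c τ)
    refine ⟨{ app c := TypeCat.ofHom (g c), naturality := fun c d k => ?_ }, ?_⟩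
    · ext τ
      refine (ht d (T.map k τ)).1 ?_
      change f.app d (g d (T.map k τ)) = f.app d (X.map k (g c τ))
      rw [hg, NatTrans.naturality_apply, NatTrans.naturality_apply, hg]
    · ext c τ
      exact hg c τ

theorem isoAt_lowerPresheaf_iff {X Y : Cᵒᵖ ⥤ Type w} {f : X ⟶ Y} {s : LowerSet C} :
    IsoAt (lowerPresheaf s) f ↔ ∀ c ∈ s, Function.Bijective (f.app (op c)) :=
  ⟨fun h _ hc => bijective_app_of_bijective_comp (h _ ⟨lowerPresheafMap (LowerSet.Iic_le.2 hc)⟩),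
    isoAt_lowerPresheaf⟩

/-- The stages of a category of presheaves on a preorder: the principal lower sets. -/
def presheafStageSystem (L : (Cᵒᵖ ⥤ Type w) ⥤ (Cᵒᵖ ⥤ Type w))
    (d : ∀ c, (L.obj (lowerPresheaf (LowerSet.Iio c))).obj (op c)) : StageSystem L C where
  stage c := lowerPresheaf (LowerSet.Iic c)
  pre c := lowerPresheaf (LowerSet.Iio c)
  stage_subsingleton _ _ := inferInstance
  pre_subsingleton _ _ := inferInstance
  pre_le _ := ⟨lowerPresheafMap fun _ h => le_of_lt h⟩
  stage_le_pre c := ⟨ofElement (d c)⟩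
  isoAt_pre c _ _ f h := isoAt_lowerPresheaf fun b hb =>
    isoAt_lowerPresheaf_iff.1 (h b hb) b le_rfl
  isIso f h := by
    rw [NatTrans.isIso_iff_isIso_app]
    exact fun c => (isIso_iff_bijective _).2 (isoAt_lowerPresheaf_iff.1 (h c.unop) c.unop le_rfl)

end LowerSets

/-! ### `▸` on presheaves is pointwise corepresentable, hence preserves limits. -/

section Presheaves

open Opposite

variable (P : Type u) [PartialOrder P]

/-- Compatible families indexed by the elements below `a` are maps of presheaves. -/
def laterPresheafEvaluation (a : P) :
    laterPresheaf P ⋙ (evaluation _ _).obj (op a) ≅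
      coyoneda.obj (op (lowerPresheaf.{u, u} (LowerSet.Iio a))) :=
  NatIso.ofComponents (fun X =>
    { hom := TypeCat.ofHom fun x =>
        { app b := TypeCat.ofHom fun h => x.1 ⟨b.unop, h.down.down⟩
          naturality b c f := by
            ext h
            exact (x.2 ⟨b.unop, h.down.down⟩ ⟨c.unop, _⟩ (leOfHom f.unop)).symm }
      inv := TypeCat.ofHom fun g =>
        ⟨fun b => g.app (op b.1) ⟨⟨b.2⟩⟩, fun b c h => (NatTrans.naturality_apply g _ _).symm⟩ })

instance laterPresheaf_preservesFiniteLimits : PreservesFiniteLimits (laterPresheaf P) where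
  preservesFiniteLimits _ _ _ := preservesLimitsOfShape_of_evaluation _ _ fun a =>
    preservesLimitsOfShape_of_natIso (laterPresheafEvaluation P a.unop).symm

end Presheaves

/-! ### Limits and `▸` in the topos of trees. -/

section Trees

open Opposite

theorem laterTrees_evaluation_preservesLimitsOfShape (J : Type) [SmallCategory J] :
    ∀ n : ℕ, PreservesLimitsOfShape J (laterTrees.{u} ⋙ (evaluation _ _).obj (op n))
  | 0 =>
    preservesLimitsOfShape_of_natIso (F := coyoneda.obj (op (lowerPresheaf.{0, u} ⊥)))
      (NatIso.ofComponents fun X =>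
        { hom := TypeCat.ofHom fun _ => PUnit.unit
          inv := TypeCat.ofHom fun _ =>
            { app n := TypeCat.ofHom fun h => h.down.down.elim
              naturality _ _ _ := by
                ext h
                exact h.down.down.elim }
          hom_inv_id := by
            ext g
            refine NatTrans.ext (funext fun n => ?_)
            ext h
            exact h.down.down.elim })
  | n + 1 => inferInstanceAs (PreservesLimitsOfShape J ((evaluation ℕᵒᵖ (Type u)).obj (op n)))

instance laterTrees_preservesFiniteLimits : PreservesFiniteLimits laterTrees.{u} where
  preservesFiniteLimits J _ _ := preservesLimitsOfShape_of_evaluation _ _ fun a =>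
    laterTrees_evaluation_preservesLimitsOfShape J a.unop

end Trees

/-! ### Sheaves on a frame, with basis elements as stages. -/

section Sheaves

open Opposite

variable {A : Type u} [Order.Frame A]

theorem lowerPresheaf_Iic_isSheaf (a : A) :
    Presheaf.IsSheaf (frameTopology A) (lowerPresheaf.{u, u} (LowerSet.Iic a)) := by
  rw [isSheaf_iff_isSheaf_of_type]
  intro c S hS x _
  have hc : c ≤ a := by
    rw [← show sSup {b | ∃ f : b ⟶ c, S f} = c from hS]
    exact sSup_le fun b ⟨f, hf⟩ => (x f hf).down.down
  exact ⟨⟨⟨hc⟩⟩, fun _ _ _ => Subsingleton.elim _ _, fun _ _ => Subsingleton.elim _ _⟩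

/-- The sheaf represented by `a`. -/
def lowerSheaf (a : A) : Sheaf (frameTopology A) (Type u) :=
  ⟨lowerPresheaf (LowerSet.Iic a), lowerPresheaf_Iic_isSheaf a⟩

instance (a : A) (T : Sheaf (frameTopology A) (Type u)) : Subsingleton (T ⟶ lowerSheaf a) :=
  ⟨fun f g => Sheaf.hom_ext (Subsingleton.elim (α := T.obj ⟶ lowerPresheaf _) f.hom g.hom)⟩

theorem isoAt_lowerSheaf_iff {X Y : Sheaf (frameTopology A) (Type u)} {f : X ⟶ Y} {a : A} :
    IsoAt (lowerSheaf a) f ↔ ∀ c ≤ a, Function.Bijective (f.hom.app (op c)) := by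
  constructor
  · intro h c hc
    have h' := h (lowerSheaf c) ⟨⟨lowerPresheafMap (LowerSet.Iic_le.2 hc)⟩⟩
    refine bijective_app_of_bijective_comp ⟨fun a b hab => ?_, fun y => ?_⟩
    · have : (⟨a⟩ : lowerSheaf c ⟶ X) = ⟨b⟩ := h'.1 (Sheaf.hom_ext hab)
      exact congrArg (·.hom) this
    · obtain ⟨g, hg⟩ := h'.2 ⟨y⟩
      exact ⟨g.hom, congrArg (·.hom) hg⟩
  · rintro h T ⟨t⟩
    have h' := isoAt_lowerPresheaf (s := LowerSet.Iic a) h T.obj ⟨t.hom⟩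
    refine ⟨fun a b hab => ?_, fun y => ?_⟩
    · exact Sheaf.hom_ext (h'.1 (congrArg (·.hom) hab))
    · obtain ⟨g, hg⟩ := h'.2 y.hom
      exact ⟨⟨g⟩, Sheaf.hom_ext hg⟩

/-- A map of sheaves that is bijective below each element of `D` is bijective below the join. -/
theorem bijective_app_of_le_sSup {X Y : Sheaf (frameTopology A) (Type u)} {f : X ⟶ Y}
    {D : Set A} (h : ∀ d ∈ D, ∀ c ≤ d, Function.Bijective (f.hom.app (op c))) {c : A}
    (hc : c ≤ sSup D) : Function.Bijective (f.hom.app (op c)) := by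
  -- This sieve covers `c` because `c ≤ sSup D` and finite meets distribute over joins.
  let S : Sieve c :=
    { arrows := fun b _ => ∃ d ∈ D, b ≤ d
      downward_closed := fun ⟨d, hd, hbd⟩ g => ⟨d, hd, (leOfHom g).trans hbd⟩ }
  have hS : S ∈ frameTopology A c := by
    refine le_antisymm (sSup_le fun _ ⟨g, _⟩ => leOfHom g) ?_
    refine (le_inf le_rfl hc).trans ?_
    rw [inf_sSup_eq]
    exact iSup₂_le fun d hd => le_sSup ⟨homOfLE inf_le_left, d, hd, inf_le_right⟩
  have hX := (isSheaf_iff_isSheaf_of_type _ _).1 X.property S hS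
  have hY := (isSheaf_iff_isSheaf_of_type _ _).1 Y.property S hS
  have hb : ∀ ⦃b⦄ (g : b ⟶ c), S g → Function.Bijective (f.hom.app (op b)) :=
    fun b _ ⟨d, hd, hbd⟩ => h d hd b hbd
  refine ⟨fun x x' hx => hX.isSeparatedFor.ext fun b g hg => (hb g hg).1 ?_, fun y => ?_⟩
  · rw [NatTrans.naturality_apply, NatTrans.naturality_apply, hx]
  · choose x hx using fun b (g : b ⟶ c) (hg : S g) => (hb g hg).2 (Y.obj.map g.op y)
    have hcomp : Presieve.FamilyOfElements.Compatible (P := X.obj) (R := S.arrows) x := by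
      intro b₁ b₂ b g₁ g₂ k₁ k₂ hk₁ hk₂ hk
      refine (hb (g₁ ≫ k₁) (S.downward_closed hk₁ g₁)).1 ?_
      rw [NatTrans.naturality_apply, NatTrans.naturality_apply, hx, hx, ← Functor.map_comp_apply,
        ← Functor.map_comp_apply, ← op_comp, ← op_comp, hk]
    obtain ⟨z, hz, -⟩ := hX x hcomp
    refine ⟨z, hY.isSeparatedFor.ext fun b g hg => ?_⟩
    rw [← NatTrans.naturality_apply, hz g hg, hx]

instance (K : Set A) : PreservesFiniteLimits (laterSheaf K) :=
  have := comp_preservesFiniteLimits ((Functor.whiskeringLeft _ _ (Type u)).obj (pred K).op)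
    (presheafToSheaf (frameTopology A) (Type u))
  comp_preservesFiniteLimits (sheafToPresheaf _ _) _

/-- The stages of the category of sheaves: the sheaves represented by the basis elements. -/
noncomputable def sheafStageSystem {K : Set A} (hK : IsBasis K) : StageSystem (laterSheaf K) K where
  stage k := lowerSheaf k.1
  pre k := lowerSheaf ((pred K).obj k.1)
  stage_subsingleton _ _ := inferInstance
  pre_subsingleton _ _ := inferInstance
  pre_le k := ⟨⟨lowerPresheafMap (LowerSet.Iic_le.2 (pred_le K k.1))⟩⟩
  -- By Yoneda an element of `▸(pre k)` at `k` is needed. The presheaf `p^*(pre k)` has one at `k`,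
  -- since `p k ≤ p k`; the unit of sheafification carries it over.
  stage_le_pre k := ⟨⟨ofElement ((toSheafify (frameTopology A)
    ((pred K).op ⋙ lowerPresheaf (LowerSet.Iic ((pred K).obj k.1)))).app (op k.1) ⟨⟨le_rfl⟩⟩)⟩⟩
  isoAt_pre k _ _ f h := isoAt_lowerSheaf_iff.2 fun c hc =>
    bijective_app_of_le_sSup (fun d hd => isoAt_lowerSheaf_iff.1 (h ⟨d, hd.1⟩ hd.2)) hc
  isIso f h := by
    have : IsIso ((sheafToPresheaf _ _).map f) := by
      rw [NatTrans.isIso_iff_isIso_app]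
      refine fun c => (isIso_iff_bijective _).2 (bijective_app_of_le_sSup
        (D := {k | k ∈ K ∧ k ≤ c.unop}) (fun d hd => isoAt_lowerSheaf_iff.1 (h ⟨d, hd.1⟩)) ?_)
      exact (hK c.unop).2 fun _ hk => le_sSup hk
    exact isIso_of_reflects_iso f (sheafToPresheaf _ _)

end Sheaves

end GuardedRec

open GuardedRec Limits

theorem mainTheorem1 :
    (∀ (A : Type u) [Order.Frame A] (K : Set A), GuardedRec.IsBasis K → K.IsWF →
      GuardedRec.ModelsGuardedDependentTypes (E := Sheaf (GuardedRec.frameTopology A) (Type u))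
        (GuardedRec.laterSheaf K) (GuardedRec.nextSheaf K)) ∧
    (∀ (P : Type u) [PartialOrder P] [WellFoundedLT P],
      GuardedRec.ModelsGuardedDependentTypes (E := Pᵒᵖ ⥤ Type u)
        (GuardedRec.laterPresheaf P) (GuardedRec.nextPresheaf P)) ∧
    GuardedRec.ModelsGuardedDependentTypes (E := GuardedRec.Trees.{u})
      GuardedRec.laterTrees GuardedRec.nextTrees := by
  refine ⟨fun A _ K hK hwf => ?_, fun P _ _ => ?_, ?_⟩
  · have : WellFoundedLT K := ⟨hwf⟩
    have : HasColimitsOfSize.{u, u} (Sheaf (frameTopology A) (Type u)) :=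
      ⟨fun _ _ => inferInstance⟩
    exact (sheafStageSystem hK).modelsGuardedDependentTypes _ fun I =>
      hasCartesianClosed_over_sheaf _ I
  -- The required element of `▸(pre c)` at `c` is the family of witnesses `b < c`.
  · exact (presheafStageSystem (laterPresheaf P) fun c =>
      ⟨fun b => ⟨⟨b.2⟩⟩, fun _ _ _ => Subsingleton.elim _ _⟩).modelsGuardedDependentTypes _
        hasCartesianClosed_over_presheaf
  · exact (presheafStageSystem laterTrees.{u} fun
      | 0 => PUnit.unit
      | n + 1 => ⟨⟨Nat.lt_succ_self n⟩⟩).modelsGuardedDependentTypes _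
        hasCartesianClosed_over_trees
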